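/- Work in the category of pointed topological spaces; maps, homotopies ($\simeq$), homotopy pullbacks and homotopy pushouts are pointed. For a map $\iota\colon A\to X$, the Ganea construction is the sequence of maps $g_n\colon G_n(\iota)\to X$ ($n\ge 0$) with $G_0=A$, $g_0=\iota$, $\alpha_0=\mathrm{id}_A$, in which $F_n$, with its projections $\beta_n\colon F_n\to G_n$ and $\eta_n\colon F_n\to A$, is the homotopy pullback of $g_n$ and $\iota$; $G_{n+1}$, with $\gamma_n\colon G_n\to G_{n+1}$ and $\alpha_{n+1}\colon A\to G_{n+1}$, is the homotopy pushout of $\beta_n$ and $\eta_n$; and $g_{n+1}=(g_n,\iota)\colon G_{n+1}\to X$ is the induced whisker map. For $k\le n$ put $\gamma_{k,n}=\gamma_{n-1}\circ\dots\circ\gamma_k\colon G_k\to G_n$, with $\gamma_{k,k}=\mathrm{id}$. A homotopy section of $g_n$ is a map $\sigma\colon X\to G_n(\iota)$ with $g_n\circ\sigma\simeq\mathrm{id}_X$. Define $\mathrm{secat}(\iota)$, $\mathrm{relcat}(\iota)$ and $\mathrm{relcat}^{k}(\iota)$ as the least integer $n$ such that $g_n$ has a homotopy section $\sigma$ satisfying,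 respectively: no further condition; $\sigma\circ\iota\simeq\alpha_n$; $n\ge k$ and $\sigma\circ g_k\simeq\gamma_{k,n}$. Each invariant is $\infty$ if there is no such integer. Let $$\begin{array}{ccc} W&\xrightarrow{\ \eta\ }&A\\ {\scriptstyle\beta}\downarrow&&\downarrow{\scriptstyle\theta}\\ A&\xrightarrow{\ \theta\ }&\Sigma_AW\end{array}$$ be a homotopy pushout (with a given homotopy $\theta\circ\beta\simeq\theta\circ\eta$), let $f\colon\Sigma_AW\to X$ be any map, and set $\iota_X=f\circ\theta\colon A\to X$. For $n\ge1$, the maps $\alpha_{n-1}\circ\beta\colon W\to G_{n-1}(\iota_X)$ and $\eta\colon W\to A$, with the homotopy $g_{n-1}\circ\alpha_{n-1}\circ\beta\simeq f\circ\theta\circ\beta\simeq f\circ\theta\circ\eta=\iota_X\circ\eta$, induce a map $W\to F_{n-1}(\iota_X)$. Composing it with the homotopy $\gamma_{n-1}\circ\beta_{n-1}\simeq\alpha_n\circ\eta_{n-1}$ gives a homotopy $\gamma_{n-1}\circ\alpha_{n-1}\circ\beta\simeq\alpha_n\circ\eta$, and $\omega_n\colon\Sigma_AW\to G_n(\iota_X)$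 is the whisker map that it induces on the homotopy pushout $\Sigma_AW$. The Hopf category $\mathrm{hcat}(f)$ is the least integer $n\ge1$ such that $g_n\colon G_n(\iota_X)\to X$ has a homotopy section $\sigma$ with $\sigma\circ f\simeq\omega_n$ ($\infty$ if there is none). **Proposition.** For every such homotopy pushout and every such $f$, $$\mathrm{secat}(f)\le\mathrm{relcat}(\iota_X)\le\mathrm{hcat}(f)\le\mathrm{relcat}^{1}(\iota_X)\le\mathrm{relcat}(\iota_X)+1.$$ Consequently $\mathrm{hcat}(f)$ is either $\mathrm{relcat}(\iota_X)$ or $\mathrm{relcat}(\iota_X)+1$. -/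

import Mathlib

universe u

namespace HopfCat

/-- A pointed topological space. -/
structure PtdSpace : Type (u + 1) where
  /-- the underlying set -/
  carrier : Type u
  /-- the topology -/
  [top : TopologicalSpace carrier]
  /-- the base point -/
  pt : carrier

instance : CoeSort PtdSpace.{u} (Type u) := ⟨PtdSpace.carrier⟩

attribute [instance] PtdSpace.top

/-- A pointed map: a continuous map that preserves the base points. -/
structure PtdMap (X Y : PtdSpace.{u}) : Type u where
  /-- the underlying continuous map -/
  toCont : C(X, Y)
  map_pt : toCont X.pt = Y.pt

instance (X Y : PtdSpace.{u}) : CoeFun (PtdMap X Y) (fun _ => X → Y) := ⟨fun f => f.toCont⟩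

/-- The identity map. -/
def PtdMap.id (X : PtdSpace.{u}) : PtdMap X X := ⟨ContinuousMap.id X, rfl⟩

/-- Composition `g ∘ f` of pointed maps. -/
def PtdMap.comp {X Y Z : PtdSpace.{u}} (g : PtdMap Y Z) (f : PtdMap X Y) : PtdMap X Z :=
  ⟨g.toCont.comp f.toCont, (congrArg g f.map_pt).trans g.map_pt⟩

/-- A pointed homotopy from `f` to `g`, that is, a homotopy that is fixed on the base point. -/
abbrev PtdHomotopy {X Y : PtdSpace.{u}} (f g : PtdMap X Y) : Type u :=
  ContinuousMap.HomotopyRel f.toCont g.toCont {X.pt}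

/-- Being homotopic as pointed maps: `f ≃ g`. -/
def PtdHomotopic {X Y : PtdSpace.{u}} (f g : PtdMap X Y) : Prop :=
  Nonempty (PtdHomotopy f g)

/-- Pointed homotopy equivalences. -/
def IsPtdHomotopyEquiv {X Y : PtdSpace.{u}} (f : PtdMap X Y) : Prop :=
  ∃ r : PtdMap Y X, PtdHomotopic (f.comp r) (PtdMap.id Y) ∧ PtdHomotopic (r.comp f) (PtdMap.id X)

/-- A homotopy takes the base point of the target as its value on the base point. -/
theorem ptdHomotopy_pt {X Y : PtdSpace.{u}} {f g : PtdMap X Y} (H : PtdHomotopy f g)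
    (t : unitInterval) :
    H (t, X.pt) = Y.pt :=
  (H.eq_fst t rfl).trans f.map_pt

/-- The homotopy `f ∘ H : f ∘ p ≃ f ∘ q` for `H : p ≃ q`. -/
def postcompHomotopy {X Y Z : PtdSpace.{u}} {p q : PtdMap X Y} (f : PtdMap Y Z)
    (H : PtdHomotopy p q) : PtdHomotopy (f.comp p) (f.comp q) :=
  ContinuousMap.HomotopyRel.compContinuousMap H f.toCont

/-- The homotopy `H ∘ w : p ∘ w ≃ q ∘ w` for `H : p ≃ q`. -/
def precompHomotopy {W X Y : PtdSpace.{u}} {p q : PtdMap X Y} (H : PtdHomotopy p q)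
    (w : PtdMap W X) : PtdHomotopy (p.comp w) (q.comp w) where
  toFun x := H (x.1, w x.2)
  continuous_toFun := by
    have := H.continuous
    have := w.toCont.continuous
    fun_prop
  map_zero_left x := H.apply_zero (w x)
  map_one_left x := H.apply_one (w x)
  prop' t x hx := by
    have hx' : x = W.pt := hx
    subst hx'
    exact H.eq_fst t w.map_pt

/-! ### Standard homotopy pullbacks -/

section Pullback

variable {A B X : PtdSpace.{u}} (f : PtdMap A X) (g : PtdMap B X)

/-- The standard homotopy pullback of `f : A → X` and `g : B → X`: triples `(a, p, b)` with `p` a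
path in `X` from `f a` to `g b`. -/
def hPullback : PtdSpace.{u} where
  carrier := {z : A × C(unitInterval, X) × B // z.2.1 0 = f z.1 ∧ z.2.1 1 = g z.2.2}
  pt := ⟨(A.pt, ContinuousMap.const unitInterval X.pt, B.pt), f.map_pt.symm, g.map_pt.symm⟩

/-- The projection of the homotopy pullback to `A`. -/
def hPullback.fst : PtdMap (hPullback f g) A where
  toCont := ⟨fun z => z.1.1, continuous_fst.comp continuous_subtype_val⟩
  map_pt := rfl

/-- The projection of the homotopy pullback to `B`. -/
def hPullback.snd : PtdMap (hPullback f g) B where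
  toCont := ⟨fun z => z.1.2.2, (continuous_snd.comp continuous_snd).comp continuous_subtype_val⟩
  map_pt := rfl

/-- The canonical homotopy `f ∘ fst ≃ g ∘ snd` of the homotopy pullback. -/
def hPullback.homotopy :
    PtdHomotopy (f.comp (hPullback.fst f g)) (g.comp (hPullback.snd f g)) where
  toFun x := x.2.1.2.1 x.1
  continuous_toFun := by
    have h1 : Continuous fun x : unitInterval × (hPullback f g) => x.2.1.2.1 :=
      (continuous_fst.comp continuous_snd).comp (continuous_subtype_val.comp continuous_snd)
    exact ContinuousEval.continuous_eval.comp (h1.prodMk continuous_fst)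
  map_zero_left x := x.2.1
  map_one_left x := x.2.2
  prop' t x hx := by
    have hx' : x = (hPullback f g).pt := hx
    subst hx'
    exact f.map_pt.symm

variable {f g}

/-- The whisker map `C → hPullback f g` induced by `p : C → A`, `q : C → B` and a homotopy
`f ∘ p ≃ g ∘ q`. -/
def hPullback.lift {C : PtdSpace.{u}} (p : PtdMap C A) (q : PtdMap C B)
    (H : PtdHomotopy (f.comp p) (g.comp q)) : PtdMap C (hPullback f g) where
  toCont :=
    { toFun := fun c => ⟨(p c, (H.toContinuousMap.comp ContinuousMap.prodSwap).curry c, q c),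
        H.apply_zero c, H.apply_one c⟩
      continuous_toFun := by
        refine Continuous.subtype_mk ?_ _
        exact p.toCont.continuous.prodMk
          ((ContinuousMap.continuous _).prodMk q.toCont.continuous) }
  map_pt := by
    apply Subtype.ext
    refine Prod.ext p.map_pt (Prod.ext ?_ q.map_pt)
    ext t
    exact ptdHomotopy_pt H t

end Pullback

/-! ### Standard homotopy pushouts -/

section Pushout

variable {A B C : PtdSpace.{u}} (v : PtdMap C A) (w : PtdMap C B)

/-- The identifications in the reduced double mapping cylinder of `A ← C → B`. -/
inductive HPushoutRel : A ⊕ (C × unitInterval) ⊕ B → A ⊕ (C × unitInterval) ⊕ B → Prop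
  | left (c : C) : HPushoutRel (Sum.inr (Sum.inl (c, 0))) (Sum.inl (v c))
  | right (c : C) : HPushoutRel (Sum.inr (Sum.inl (c, 1))) (Sum.inr (Sum.inr (w c)))
  | base (t : unitInterval) : HPushoutRel (Sum.inr (Sum.inl (C.pt, t))) (Sum.inl A.pt)

/-- The standard homotopy pushout of `v : C → A` and `w : C → B` in pointed spaces: the reduced
double mapping cylinder, with `(c, 0)` glued to `v c` and `(c, 1)` to `w c`. -/
def hPushout : PtdSpace.{u} where
  carrier := Quot (HPushoutRel v w)
  pt := Quot.mk _ (Sum.inl A.pt)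

/-- The inclusion of `A` in the homotopy pushout. -/
def hPushout.inl : PtdMap A (hPushout v w) where
  toCont := ⟨fun a => Quot.mk _ (Sum.inl a), continuous_quot_mk.comp continuous_inl⟩
  map_pt := rfl

/-- The inclusion of `B` in the homotopy pushout. -/
def hPushout.inr : PtdMap B (hPushout v w) where
  toCont := ⟨fun b => Quot.mk _ (Sum.inr (Sum.inr b)),
    continuous_quot_mk.comp (continuous_inr.comp continuous_inr)⟩
  map_pt := by
    have h1 := Quot.sound (HPushoutRel.right (v := v) (w := w) C.pt)
    have h2 := Quot.sound (HPushoutRel.base (v := v) (w := w) 1)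
    rw [w.map_pt] at h1
    exact h1.symm.trans h2

/-- The canonical homotopy `inl ∘ v ≃ inr ∘ w` of the homotopy pushout. -/
def hPushout.homotopy :
    PtdHomotopy ((hPushout.inl v w).comp v) ((hPushout.inr v w).comp w) where
  toFun x := Quot.mk _ (Sum.inr (Sum.inl (x.2, x.1)))
  continuous_toFun := continuous_quot_mk.comp
    (continuous_inr.comp (continuous_inl.comp continuous_swap))
  map_zero_left c := Quot.sound (HPushoutRel.left c)
  map_one_left c := Quot.sound (HPushoutRel.right c)
  prop' t x hx := by
    have hx' : x = C.pt := hx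
    subst hx'
    exact (Quot.sound (HPushoutRel.base t)).trans
      (congrArg (fun a => Quot.mk (HPushoutRel v w) (Sum.inl a)) v.map_pt.symm)

variable {v w}

/-- The whisker map `hPushout v w → Y` induced by `p : A → Y`, `q : B → Y` and a homotopy
`p ∘ v ≃ q ∘ w`. -/
def hPushout.desc {Y : PtdSpace.{u}} (p : PtdMap A Y) (q : PtdMap B Y)
    (H : PtdHomotopy (p.comp v) (q.comp w)) : PtdMap (hPushout v w) Y where
  toCont :=
    { toFun := Quot.lift (Sum.elim p (Sum.elim (fun x => H (x.2, x.1)) q)) (by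
        intro a b h
        cases h with
        | left c => exact H.apply_zero c
        | right c => exact H.apply_one c
        | base t => exact (ptdHomotopy_pt H t).trans p.map_pt.symm)
      continuous_toFun := by
        refine continuous_quot_lift _ ?_
        exact p.toCont.continuous.sumElim
          ((H.continuous.comp continuous_swap).sumElim q.toCont.continuous) }
  map_pt := p.map_pt

end Pushout

/-! ### The Ganea construction -/

/-- A pointed space with a pointed map to `X`. -/
structure SpaceOver (X : PtdSpace.{u}) : Type (u + 1) where
  /-- the space -/
  space : PtdSpace.{u}
  /-- its map to `X` -/
  map : PtdMap space X

section Ganea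

variable {A X : PtdSpace.{u}} (ι : PtdMap A X)

/-- The step `g_i ↦ g_{i+1}` of the Ganea construction: the fibre space `F_i` is the homotopy
pullback of `g_i` and `ι`, the space `G_{i+1}` is the homotopy pushout of `G_i ← F_i → A`, and
`g_{i+1} = (g_i, ι)` is the whisker map. -/
def ganeaStep (G : SpaceOver X) : SpaceOver X where
  space := hPushout (hPullback.fst G.map ι) (hPullback.snd G.map ι)
  map := hPushout.desc G.map ι (hPullback.homotopy G.map ι)

/-- The Ganea construction of `ι`, starting with `g_0 = ι`. -/
def ganea : ℕ → SpaceOver X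
  | 0 => ⟨A, ι⟩
  | n + 1 => ganeaStep ι (ganea n)

/-- The space `G_n(ι)`. -/
abbrev G (n : ℕ) : PtdSpace.{u} := (ganea ι n).space

/-- The map `g_n : G_n(ι) → X`. -/
abbrev g (n : ℕ) : PtdMap (G ι n) X := (ganea ι n).map

/-- The space `F_n(ι)`, the homotopy pullback of `g_n` and `ι`. -/
abbrev F (n : ℕ) : PtdSpace.{u} := hPullback (g ι n) ι

/-- The map `β_n : F_n → G_n`. -/
abbrev β (n : ℕ) : PtdMap (F ι n) (G ι n) := hPullback.fst (g ι n) ι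

/-- The map `η_n : F_n → A`. -/
abbrev η (n : ℕ) : PtdMap (F ι n) A := hPullback.snd (g ι n) ι

/-- The map `α_n : A → G_n`, with `α_0 = id`. -/
def α : (n : ℕ) → PtdMap A (G ι n)
  | 0 => PtdMap.id A
  | n + 1 => hPushout.inr (β ι n) (η ι n)

/-- The map `γ_n : G_n → G_{n+1}`. -/
def γ (n : ℕ) : PtdMap (G ι n) (G ι (n + 1)) := hPushout.inl (β ι n) (η ι n)

/-- The canonical homotopy `γ_n ∘ β_n ≃ α_{n+1} ∘ η_n` of the pushout square. -/
def ganeaHomotopy (n : ℕ) : PtdHomotopy ((γ ι n).comp (β ι n)) ((α ι (n + 1)).comp (η ι n)) :=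
  hPushout.homotopy (β ι n) (η ι n)

/-- The composite `γ_{k,n} = γ_{n-1} ∘ ⋯ ∘ γ_k : G_k → G_n` for `k ≤ n`, with `γ_{k,k} = id`. -/
def γIter (k n : ℕ) (h : k ≤ n) : PtdMap (G ι k) (G ι n) :=
  Nat.leRec (motive := fun m _ => PtdMap (G ι k) (G ι m)) (PtdMap.id (G ι k))
    (fun m _ φ => (γ ι m).comp φ) h

theorem g_comp_α (n : ℕ) : (g ι n).comp (α ι n) = ι := by
  cases n <;> rfl

/-- `σ` is a homotopy section of `g_n`. -/
def IsGaneaSection (n : ℕ) (σ : PtdMap X (G ι n)) : Prop :=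
  PtdHomotopic ((g ι n).comp σ) (PtdMap.id X)

/-- The sectional category: the least `n` such that `g_n` has a homotopy section (`⊤` if there
is none). -/
noncomputable def secat : ℕ∞ :=
  ⨅ (n : ℕ) (_ : ∃ σ : PtdMap X (G ι n), IsGaneaSection ι n σ), (n : ℕ∞)

/-- The relative category: the least `n` such that `g_n` has a homotopy section `σ` with
`σ ∘ ι ≃ α_n`. -/
noncomputable def relcat : ℕ∞ :=
  ⨅ (n : ℕ) (_ : ∃ σ : PtdMap X (G ι n),
    IsGaneaSection ι n σ ∧ PtdHomotopic (σ.comp ι) (α ι n)), (n : ℕ∞)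

/-- The relative category of order `k`: the least `n` (necessarily `≥ k`) such that `g_n` has a
homotopy section `σ` with `σ ∘ g_k ≃ γ_{k,n}`. -/
noncomputable def relcatOrder (k : ℕ) : ℕ∞ :=
  ⨅ (n : ℕ) (_ : ∃ (h : k ≤ n) (σ : PtdMap X (G ι n)),
    IsGaneaSection ι n σ ∧ PtdHomotopic (σ.comp (g ι k)) (γIter ι k n h)), (n : ℕ∞)

end Ganea

/-! ### Relative suspensions and the Hopf category -/

/-- A relative suspension `S = Σ_A W`: a homotopy pushout of `β, η : W → A` in which both maps
`A → S` are the same map `θ`. A homotopy `θ ∘ β ≃ θ ∘ η` is given, and the whisker map to `S`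
from the standard homotopy pushout is a homotopy equivalence. -/
structure RelSuspension (W A S : PtdSpace.{u}) : Type u where
  /-- the map from the corner of the square opposite to `S` to the first copy of `A` -/
  β : PtdMap W A
  /-- the map to the second copy of `A` -/
  η : PtdMap W A
  /-- the map from both copies of `A` -/
  θ : PtdMap A S
  /-- the homotopy filling the square -/
  H : PtdHomotopy (θ.comp β) (θ.comp η)
  /-- the square is a homotopy pushout -/
  isPushout : IsPtdHomotopyEquiv (hPushout.desc θ θ H)

section Hopf

variable {W A S X : PtdSpace.{u}} (D : RelSuspension W A S) (f : PtdMap S X)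

namespace RelSuspension

/-- A homotopy inverse of the comparison map `hPushout.desc θ θ H` from the standard homotopy
pushout to `S` (unique up to homotopy). -/
noncomputable def comparisonInv : PtdMap S (hPushout D.β D.η) := Classical.choose D.isPushout

/-- The whisker map `S → Y` induced by `p, q : A → Y` and a homotopy `p ∘ β ≃ q ∘ η`. -/
noncomputable def whisker {Y : PtdSpace.{u}} (p q : PtdMap A Y)
    (K : PtdHomotopy (p.comp D.β) (q.comp D.η)) : PtdMap S Y :=
  (hPushout.desc p q K).comp D.comparisonInv

end RelSuspension

/-- The map `ι_X = f ∘ θ : A → X`. -/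
def iotaX : PtdMap A X := f.comp D.θ

/-- The map `W → F_m(ι_X)` induced by `α_m ∘ β : W → G_m`, by `η : W → A` and by the homotopy
`g_m ∘ α_m ∘ β = f ∘ θ ∘ β ≃ f ∘ θ ∘ η = ι_X ∘ η`. -/
def toFibre (m : ℕ) : PtdMap W (F (iotaX D f) m) :=
  hPullback.lift ((α (iotaX D f) m).comp D.β) D.η
    (ContinuousMap.HomotopyRel.cast (postcompHomotopy f D.H)
      (congrArg (fun j : PtdMap A X => (j.comp D.β).toCont) (g_comp_α (iotaX D f) m).symm) rfl)

/-- The map `ω_{m+1} : S → G_{m+1}(ι_X)` induced on the homotopy pushout `S` by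
`γ_m ∘ α_m` and `α_{m+1}`, with the homotopy `γ_m ∘ α_m ∘ β ≃ α_{m+1} ∘ η` obtained from that of
the square defining `G_{m+1}` along the map `W → F_m`. -/
noncomputable def omegaSucc (m : ℕ) : PtdMap S (G (iotaX D f) (m + 1)) :=
  D.whisker ((γ (iotaX D f) m).comp (α (iotaX D f) m)) (α (iotaX D f) (m + 1))
    (precompHomotopy (ganeaHomotopy (iotaX D f) m) (toFibre D f m))

/-- The Hopf category of `f`: the least `n = m + 1 ≥ 1` such that `g_n(ι_X)` has a homotopy
section `σ` with `σ ∘ f ≃ ω_n` (`⊤` if there is none). -/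
noncomputable def hcat : ℕ∞ :=
  ⨅ (m : ℕ) (_ : ∃ σ : PtdMap X (G (iotaX D f) (m + 1)),
    IsGaneaSection (iotaX D f) (m + 1) σ ∧ PtdHomotopic (σ.comp f) (omegaSucc D f m)),
    ((m + 1 : ℕ) : ℕ∞)

end Hopf

end HopfCat

/-!
Write `ι = f ∘ θ`. The inequality `secat f ≤ relcat ι` holds because `θ` induces maps
`G_n(ι) → G_n(f)` over `X`, and `relcat ι ≤ hcat f` because `ω_n ∘ θ ≃ α_n`.

The other inequalities rest on lifts of whisker maps to the Ganea spaces. Given `v, w : C → A` and a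
homotopy `H : ι ∘ v ≃ ι ∘ w`, the whisker map `(ι, ι)` from the homotopy pushout of `v` and `w` to
`X` has a canonical lift `ganeaLift H n` to `G_{n+1}`, whose value at the height `t` over `c` is the
point at the height `t` over `(α_n (v c), H (-, c), w c)` in `F_n`. For a relative suspension it is
`ω_{n+1}`, up to the identification of `S` with the standard homotopy pushout, and for the homotopy
pushout `G_1` itself and `n = 0` it is the identity. Two general facts about such lifts do the work.
By `whiskerLift_homotopic`, the starting point `α_n (v c)` and the path `H (-, c)` may be moved
together as long as the starting point is a function of `v c`. By `inl_comp_desc_homotopic`, a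
homotopy in `G_n` between maps that factor through `v` and `w` may be traded, once mapped to
`G_{n+1}`, for the cylinder coordinate.

They give `γ ∘ ganeaLift H n ≃ ganeaLift H (n + 1)` (`γ_comp_ganeaLift`). Hence
`γ_{1,n} ∘ ω_1 ≃ ω_n`, and since `g_1 ∘ ω_1 ≃ f`, a section `r` with `r ∘ g_1 ≃ γ_{1,n}` satisfies
`r ∘ f ≃ r ∘ g_1 ∘ ω_1 ≃ ω_n`; this is `hcat f ≤ relcat¹ ι`. Applied to `G_1` they show that
`γ_{1,n+1}` is the canonical lift of `g_1`. If `r` is a homotopy section of `g_n` with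
`r ∘ ι ≃ α_n`, then `γ_n ∘ r ∘ g_1` is homotopic to the same lift
(`inl_comp_section_comp_desc_homotopic`), which is `relcat¹ ι ≤ relcat ι + 1`. The difficulty there
is that the homotopies `g_n ∘ r ≃ id` and `r ∘ ι ≃ α_n` are unrelated; the loops that measure their
difference are absorbed by letting the starting point run through their images under `r`.
-/

namespace HopfCat

open unitInterval

/-! ### Reparametrizations of the unit interval -/

/-- `min (2t) 1`, as a point of the unit interval. -/
noncomputable def firstHalf (t : I) : I := Set.projIcc 0 1 zero_le_one (2 * (t : ℝ))

/-- `max (2t - 1) 0`, as a point of the unit interval. -/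
noncomputable def secondHalf (t : I) : I := Set.projIcc 0 1 zero_le_one (2 * (t : ℝ) - 1)

/-- The point `(1 - s) x + s y` of the unit interval. -/
noncomputable def segment (s x y : I) : I :=
  ⟨(1 - s) * x + s * y,
    (convex_Icc (0 : ℝ) 1) x.2 y.2 (sub_nonneg.2 s.2.2) s.2.1 (by ring)⟩

@[fun_prop]
theorem continuous_firstHalf : Continuous firstHalf := by
  unfold firstHalf; exact continuous_projIcc.comp (by fun_prop)

@[fun_prop]
theorem continuous_secondHalf : Continuous secondHalf := by
  unfold secondHalf; exact continuous_projIcc.comp (by fun_prop)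

theorem continuous_segment {Z : Type*} [TopologicalSpace Z] {s x y : Z → I} (hs : Continuous s)
    (hx : Continuous x) (hy : Continuous y) : Continuous fun z => segment (s z) (x z) (y z) := by
  unfold segment
  exact Continuous.subtype_mk (by fun_prop) _

@[simp] theorem segment_zero (x y : I) : segment 0 x y = x := Subtype.ext (by simp [segment])
@[simp] theorem segment_one (x y : I) : segment 1 x y = y := Subtype.ext (by simp [segment])
@[simp] theorem segment_self (s x : I) : segment s x x = x :=
  Subtype.ext (by simp only [segment]; ring)
@[simp] theorem segment_zero_one (s : I) : segment s 0 1 = s := Subtype.ext (by simp [segment])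
@[simp] theorem firstHalf_zero : firstHalf 0 = 0 := by simp [firstHalf]
@[simp] theorem firstHalf_one : firstHalf 1 = 1 := by
  simp [firstHalf, Set.projIcc_of_right_le zero_le_one (one_le_two : (1 : ℝ) ≤ 2)]
@[simp] theorem secondHalf_zero : secondHalf 0 = 0 := by
  simp [secondHalf, Set.projIcc_of_le_left zero_le_one (by norm_num : (-1 : ℝ) ≤ 0)]
@[simp] theorem secondHalf_one : secondHalf 1 = 1 := by
  simp only [secondHalf, Set.Icc.coe_one]; norm_num

theorem firstHalf_eq_one_or_secondHalf_eq_zero (t : I) : firstHalf t = 1 ∨ secondHalf t = 0 := by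
  rcases le_total (1 : ℝ) (2 * (t : ℝ)) with h | h
  · exact Or.inl (Set.projIcc_of_right_le _ h)
  · exact Or.inr (Set.projIcc_of_le_left _ (by linarith))

/-- The point `max (s + t - 1) 0` of the unit interval. -/
noncomputable def truncSum (s t : I) : I := Set.projIcc 0 1 zero_le_one (s + t - 1 : ℝ)

theorem continuous_truncSum {Z : Type*} [TopologicalSpace Z] {s t : Z → I} (hs : Continuous s)
    (ht : Continuous t) : Continuous fun z => truncSum (s z) (t z) :=
  continuous_projIcc.comp (by fun_prop)

theorem truncSum_one_left (t : I) : truncSum 1 t = t := by simp [truncSum]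

theorem truncSum_one_right (s : I) : truncSum s 1 = s := by simp [truncSum]

theorem truncSum_symm (s : I) : truncSum s (σ s) = 0 := by
  simp [truncSum, unitInterval.coe_symm_eq]

/-! ### Prepending the end of a path to another path -/

section Prepend

variable {V : Type*}

/-- The path that runs along `τ` from the parameter `1 - s` to its end, and then along `p`. For
`s = 0` it is `p` itself. -/
noncomputable def prepend (τ p : I → V) (s t : I) : V :=
  if (t : ℝ) - s * (1 - t) ≤ 0 then τ (Set.projIcc 0 1 zero_le_one (1 + (t - s * (1 - t)) : ℝ))
  else p (Set.projIcc 0 1 zero_le_one (t - s * (1 - t) : ℝ))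

theorem continuous_prepend {Z : Type*} [TopologicalSpace Z] [TopologicalSpace V]
    {τ p : Z → I → V} {s t : Z → I} (hτ : Continuous fun x : Z × I => τ x.1 x.2)
    (hp : Continuous fun x : Z × I => p x.1 x.2) (h : ∀ z, τ z 1 = p z 0)
    (hs : Continuous s) (ht : Continuous t) :
    Continuous fun z => prepend (τ z) (p z) (s z) (t z) := by
  have hv : Continuous fun z => (t z : ℝ) - s z * (1 - t z) := by fun_prop
  unfold prepend
  refine Continuous.if_le
    (hτ.comp (continuous_id.prodMk ((continuous_projIcc (h := zero_le_one' ℝ)).comp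
      (continuous_const.add hv))))
    (hp.comp (continuous_id.prodMk ((continuous_projIcc (h := zero_le_one' ℝ)).comp hv)))
    hv continuous_const (fun z hz => ?_)
  simp only [hz, add_zero, Set.projIcc_left, Set.projIcc_right]
  exact h z

variable {τ p : I → V}

theorem prepend_zero (h : τ 1 = p 0) (t : I) : prepend τ p 0 t = p t := by
  unfold prepend
  split_ifs with ht
  · have ht' : (t : ℝ) ≤ 0 := by simpa using ht
    obtain rfl : t = 0 := Subtype.ext (le_antisymm ht' t.2.1)
    simpa using h
  · simp

theorem prepend_left (s : I) : prepend τ p s 0 = τ (σ s) := by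
  have e : (1 + ((0 : I) - s * (1 - (0 : I))) : ℝ) = σ s := by
    simp [unitInterval.coe_symm_eq, sub_eq_add_neg]
  unfold prepend
  rw [if_pos (by simpa using s.2.1), e, Set.projIcc_val]

theorem prepend_right (s : I) : prepend τ p s 1 = p 1 := by
  simp [prepend]

theorem prepend_of_forall_eq {x : V} (hτ : ∀ t, τ t = x) (hp : ∀ t, p t = x) (s t : I) :
    prepend τ p s t = x := by
  unfold prepend
  split_ifs
  exacts [hτ _, hp _]

/-- Concatenating two sides of a square. -/
theorem prepend_one (D : I → I → V) (t : I) :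
    prepend (fun x => D x 0) (D 1) 1 t = D (firstHalf t) (secondHalf t) := by
  unfold prepend firstHalf secondHalf
  have e : (t : ℝ) - (1 : I) * (1 - t) = 2 * t - 1 := by
    rw [Set.Icc.coe_one]; ring
  rw [e]
  split_ifs with ht
  · rw [Set.projIcc_of_le_left zero_le_one ht, add_sub_cancel]
    rfl
  · rw [Set.projIcc_of_right_le zero_le_one (by linarith : (1 : ℝ) ≤ 2 * t)]
    rfl

end Prepend

/-! ### Homotopies between pointed maps -/

section Homotopic

variable {X Y Z : PtdSpace.{u}}

/-- The pointed homotopy with underlying function `K`. -/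
def PtdHomotopy.mk {p q : PtdMap X Y} (K : I → X → Y)
    (hK : Continuous fun x : I × X => K x.1 x.2) (h0 : ∀ x, K 0 x = p x) (h1 : ∀ x, K 1 x = q x)
    (hpt : ∀ t, K t X.pt = Y.pt) : PtdHomotopy p q where
  toFun x := K x.1 x.2
  continuous_toFun := hK
  map_zero_left := h0
  map_one_left := h1
  prop' t x hx := by
    have hx' : x = X.pt := hx
    subst hx'
    exact (hpt t).trans p.map_pt.symm

theorem PtdHomotopic.refl (p : PtdMap X Y) : PtdHomotopic p p :=
  ContinuousMap.HomotopicRel.refl p.toCont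

theorem PtdHomotopic.symm {p q : PtdMap X Y} (h : PtdHomotopic p q) : PtdHomotopic q p :=
  ContinuousMap.HomotopicRel.symm h

theorem PtdHomotopic.trans {p q r : PtdMap X Y} (h : PtdHomotopic p q) (h' : PtdHomotopic q r) :
    PtdHomotopic p r :=
  ContinuousMap.HomotopicRel.trans h h'

theorem PtdHomotopic.postcomp {p q : PtdMap X Y} (f : PtdMap Y Z) (h : PtdHomotopic p q) :
    PtdHomotopic (f.comp p) (f.comp q) :=
  h.map (postcompHomotopy f)

theorem PtdHomotopic.precomp {p q : PtdMap Y Z} (h : PtdHomotopic p q) (w : PtdMap X Y) :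
    PtdHomotopic (p.comp w) (q.comp w) :=
  h.map fun H => precompHomotopy H w

theorem PtdMap.ext_apply {p q : PtdMap X Y} (h : ∀ x, p x = q x) : p = q := by
  cases p; cases q; congr 1; exact ContinuousMap.ext h

end Homotopic

/-! ### Homotopies out of a homotopy pushout -/

section Pushout

variable {A B C Y : PtdSpace.{u}} {v : PtdMap C A} {w : PtdMap C B}

/-- The point of the homotopy pushout at height `t` of the cylinder over `c`. -/
abbrev hPushout.cyl (v : PtdMap C A) (w : PtdMap C B) (c : C) (t : I) : hPushout v w :=
  hPushout.homotopy v w (t, c)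

theorem hPushout.continuous_cyl {Z : Type*} [TopologicalSpace Z] {c : Z → C} {t : Z → I}
    (hc : Continuous c) (ht : Continuous t) :
    Continuous fun z => hPushout.cyl v w (c z) (t z) :=
  (hPushout.homotopy v w).continuous.comp (ht.prodMk hc)

theorem hPushout.cyl_pt (t : I) : hPushout.cyl v w C.pt t = (hPushout v w).pt :=
  ptdHomotopy_pt _ t

theorem hPushout.cyl_zero (c : C) : hPushout.cyl v w c 0 = hPushout.inl v w (v c) :=
  (hPushout.homotopy v w).apply_zero c

theorem hPushout.cyl_one (c : C) : hPushout.cyl v w c 1 = hPushout.inr v w (w c) :=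
  (hPushout.homotopy v w).apply_one c

theorem hPushout.ind {p : hPushout v w → Prop} (hl : ∀ a, p (hPushout.inl v w a))
    (hc : ∀ c t, p (hPushout.cyl v w c t)) (hr : ∀ b, p (hPushout.inr v w b)) (x) : p x := by
  induction x using Quot.ind with
  | mk x =>
    rcases x with a | ⟨c, t⟩ | b
    · exact hl a
    · exact hc c t
    · exact hr b

theorem continuous_of_sum_prod {S T Z V : Type*} [TopologicalSpace S] [TopologicalSpace T]
    [TopologicalSpace Z] [TopologicalSpace V] {f : (S ⊕ T) × Z → V}
    (h₁ : Continuous fun x : S × Z => f (Sum.inl x.1, x.2))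
    (h₂ : Continuous fun x : T × Z => f (Sum.inr x.1, x.2)) : Continuous f :=
  Homeomorph.sumProdDistrib.symm.comp_continuous_iff'.1 (continuous_sum_dom.2 ⟨h₁, h₂⟩)

/-- Maps out of a homotopy pushout are homotopic if they are so, compatibly, on its three parts.
The homotopy is continuous because the unit interval is locally compact. -/
theorem hPushout.homotopic_of {φ ψ : PtdMap (hPushout v w) Y}
    (P : I → A → Y) (K : I → C → I → Y) (Q : I → B → Y)
    (hP : Continuous fun x : I × A => P x.1 x.2)
    (hK : Continuous fun x : I × C × I => K x.1 x.2.1 x.2.2)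
    (hQ : Continuous fun x : I × B => Q x.1 x.2)
    (hl : ∀ s c, K s c 0 = P s (v c)) (hr : ∀ s c, K s c 1 = Q s (w c))
    (hpt : ∀ s, P s A.pt = Y.pt) (hKpt : ∀ s t, K s C.pt t = Y.pt)
    (hP0 : ∀ a, P 0 a = φ (hPushout.inl v w a)) (hP1 : ∀ a, P 1 a = ψ (hPushout.inl v w a))
    (hK0 : ∀ c t, K 0 c t = φ (hPushout.cyl v w c t))
    (hK1 : ∀ c t, K 1 c t = ψ (hPushout.cyl v w c t))
    (hQ0 : ∀ b, Q 0 b = φ (hPushout.inr v w b)) (hQ1 : ∀ b, Q 1 b = ψ (hPushout.inr v w b)) :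
    PtdHomotopic φ ψ := by
  let T : I → hPushout v w → Y := fun s =>
    Quot.lift (Sum.elim (P s) (Sum.elim (fun x => K s x.1 x.2) (Q s))) (by
      intro a b h
      cases h with
      | left c => exact hl s c
      | right c => exact hr s c
      | base t => exact (hKpt s t).trans (hpt s).symm)
  have hT : Continuous fun x : I × hPushout v w => T x.1 x.2 := by
    refine (isQuotientMap_quot_mk (r := HPushoutRel v w)).continuous_lift_prod_right
      (g := fun x : I × hPushout v w => T x.1 x.2) ?_
    have e : Continuous fun x : (A ⊕ (C × I) ⊕ B) × I =>
        T x.2 (Quot.mk (HPushoutRel v w) x.1) := by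
      refine continuous_of_sum_prod (hP.comp continuous_swap)
        (continuous_of_sum_prod ?_ (hQ.comp continuous_swap))
      exact hK.comp (continuous_snd.prodMk (continuous_fst.comp continuous_fst |>.prodMk
        (continuous_snd.comp continuous_fst)))
    exact e.comp continuous_swap
  exact ⟨PtdHomotopy.mk T hT (hPushout.ind hP0 hK0 hQ0) (hPushout.ind hP1 hK1 hQ1) hpt⟩

end Pushout

/-! ### Lifts through one step of the Ganea construction -/

section Pullback

variable {A B X : PtdSpace.{u}} {k : PtdMap A X} {ι : PtdMap B X}

/-- The continuous family of points of a homotopy pullback with components `a z`, `l z`, `b z`. -/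
def hPullback.family {Z : Type*} [TopologicalSpace Z] (a : Z → A) (l : Z → I → X) (b : Z → B)
    (ha : Continuous a) (hl : Continuous fun x : Z × I => l x.1 x.2) (hb : Continuous b)
    (h0 : ∀ z, l z 0 = k (a z)) (h1 : ∀ z, l z 1 = ι (b z)) : C(Z, hPullback k ι) where
  toFun z := ⟨(a z, (⟨fun x : Z × I => l x.1 x.2, hl⟩ : C(Z × I, X)).curry z, b z), h0 z, h1 z⟩
  continuous_toFun := Continuous.subtype_mk
    (ha.prodMk ((ContinuousMap.continuous _).prodMk hb)) _

theorem hPullback.ext {x y : hPullback k ι} (h₁ : x.1.1 = y.1.1)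
    (h₂ : ∀ t, x.1.2.1 t = y.1.2.1 t) (h₃ : x.1.2.2 = y.1.2.2) : x = y :=
  Subtype.ext (Prod.ext h₁ (Prod.ext (ContinuousMap.ext h₂) h₃))

end Pullback

section WhiskerLift

variable {A' B C G X : PtdSpace.{u}} {v : PtdMap C A'} {w : PtdMap C B}
  {k : PtdMap G X} {ι : PtdMap B X}

/-- The lift of the whisker map `(k ∘ p, ι) : hPushout v w → X`, formed with a homotopy `H`, to the
homotopy pushout of `G ← hPullback k ι → B`: the cylinder coordinate `(c, t)` goes to
`((p (v c), H (-, c), w c), t)`. -/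
def whiskerLift (p : PtdMap A' G) (H : PtdHomotopy (k.comp (p.comp v)) (ι.comp w)) :
    PtdMap (hPushout v w) (hPushout (hPullback.fst k ι) (hPullback.snd k ι)) :=
  hPushout.desc ((hPushout.inl _ _).comp p) (hPushout.inr _ _)
    (precompHomotopy (hPushout.homotopy (hPullback.fst k ι) (hPullback.snd k ι))
      (hPullback.lift (p.comp v) w H))

/-- The lift `whiskerLift p H` depends only on the homotopy class of the pair `(p, H)`: a homotopy
of `p` together with a family of paths `L s - c` joining `k (P s (v c))` to `ι (w c)`. -/
theorem whiskerLift_homotopic {p₀ p₁ : PtdMap A' G}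
    {H₀ : PtdHomotopy (k.comp (p₀.comp v)) (ι.comp w)}
    {H₁ : PtdHomotopy (k.comp (p₁.comp v)) (ι.comp w)}
    (P : I → A' → G) (L : I → I → C → X)
    (hP : Continuous fun x : I × A' => P x.1 x.2)
    (hL : Continuous fun x : (I × C) × I => L x.1.1 x.2 x.1.2)
    (hP0 : ∀ a, P 0 a = p₀ a) (hP1 : ∀ a, P 1 a = p₁ a) (hPpt : ∀ s, P s A'.pt = G.pt)
    (hl : ∀ s c, L s 0 c = k (P s (v c))) (hr : ∀ s c, L s 1 c = ι (w c))
    (hL0 : ∀ t c, L 0 t c = H₀ (t, c)) (hL1 : ∀ t c, L 1 t c = H₁ (t, c))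
    (hLpt : ∀ s t, L s t C.pt = X.pt) :
    PtdHomotopic (whiskerLift p₀ H₀) (whiskerLift p₁ H₁) := by
  let E : C(I × C, hPullback k ι) := hPullback.family (fun x => P x.1 (v x.2))
    (fun x t => L x.1 t x.2) (fun x => w x.2)
    (hP.comp (continuous_fst.prodMk (v.toCont.continuous.comp continuous_snd))) hL
    (w.toCont.continuous.comp continuous_snd) (fun x => hl x.1 x.2) (fun x => hr x.1 x.2)
  have hE0 (c : C) : E (0, c) = hPullback.lift (p₀.comp v) w H₀ c :=
    hPullback.ext (hP0 _) (fun t => hL0 t c) rfl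
  have hE1 (c : C) : E (1, c) = hPullback.lift (p₁.comp v) w H₁ c :=
    hPullback.ext (hP1 _) (fun t => hL1 t c) rfl
  have hEpt (s : I) : E (s, C.pt) = (hPullback k ι).pt :=
    hPullback.ext ((congrArg (P s) v.map_pt).trans (hPpt s)) (fun t => hLpt s t) w.map_pt
  refine hPushout.homotopic_of (fun s a => hPushout.inl _ _ (P s a))
    (fun s c t => hPushout.cyl _ _ (E (s, c)) t) (fun _ b => hPushout.inr _ _ b)
    ((hPushout.inl _ _).toCont.continuous.comp hP)
    (hPushout.continuous_cyl
      (E.continuous.comp (continuous_fst.prodMk (continuous_fst.comp continuous_snd)))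
      (continuous_snd.comp continuous_snd))
    ((hPushout.inr _ _).toCont.continuous.comp continuous_snd)
    (fun s c => hPushout.cyl_zero _) (fun s c => hPushout.cyl_one _)
    (fun s => (congrArg _ (hPpt s)).trans (hPushout.inl _ _).map_pt)
    (fun s t => ?_) (fun a => congrArg _ (hP0 a)) (fun a => congrArg _ (hP1 a))
    (fun c t => ?_) (fun c t => ?_) (fun _ => rfl) (fun _ => rfl)
  · simp only [hEpt, hPushout.cyl_pt]
  · simp only [hE0]; rfl
  · simp only [hE1]; rfl

/-- Let `e : p ∘ v ≃ q ∘ w` be a homotopy in `G`, and suppose that its paths can be pushed along: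
there are paths `L u - c` from `k (e (u, c))` to `ι (w c)`, and those for `u = 1` depend only on
`w c`. Then in the pushout of `G ← hPullback k ι → B` the homotopy `e` may be traded for the
cylinder coordinate: `inl ∘ (p, q) ≃ whiskerLift p (L 0)`. On the square with sides `u` and the
cylinder coordinate `τ`, one deforms the path along `τ = 0` and then `u = 1` into the path along
`u = 0` and then `τ = 1`; the latter side is constant. -/
theorem inl_comp_desc_homotopic {p : PtdMap A' G} {q : PtdMap B G}
    {e : PtdHomotopy (p.comp v) (q.comp w)} {H : PtdHomotopy (k.comp (p.comp v)) (ι.comp w)}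
    (L : I → I → C → X) (Φ : I → B → X)
    (hL : Continuous fun x : (I × C) × I => L x.1.1 x.2 x.1.2)
    (hΦ : Continuous fun x : B × I => Φ x.2 x.1)
    (hl : ∀ u c, L u 0 c = k (e (u, c))) (hr : ∀ u c, L u 1 c = ι (w c))
    (hL0 : ∀ t c, L 0 t c = H (t, c)) (hL1 : ∀ t c, L 1 t c = Φ t (w c))
    (hΦ0 : ∀ b, Φ 0 b = k (q b)) (hΦ1 : ∀ b, Φ 1 b = ι b)
    (hLpt : ∀ u t, L u t C.pt = X.pt) :
    PtdHomotopic ((hPushout.inl (hPullback.fst k ι) (hPullback.snd k ι)).comp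
      (hPushout.desc p q e)) (whiskerLift p H) := by
  let E : C(I × C, hPullback k ι) := hPullback.family (fun x => e (x.1, x.2))
    (fun x t => L x.1 t x.2) (fun x => w x.2) e.continuous hL
    (w.toCont.continuous.comp continuous_snd) (fun x => hl x.1 x.2) (fun x => hr x.1 x.2)
  let φ : C(B, hPullback k ι) := hPullback.family q (fun b t => Φ t b) (fun b => b)
    q.toCont.continuous hΦ continuous_id hΦ0 hΦ1
  have hE0 (c : C) : E (0, c) = hPullback.lift (p.comp v) w H c :=
    hPullback.ext (e.apply_zero c) (fun t => hL0 t c) rfl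
  have hE1 (c : C) : E (1, c) = φ (w c) :=
    hPullback.ext (e.apply_one c) (fun t => hL1 t c) rfl
  have hEpt (u : I) : E (u, C.pt) = (hPullback k ι).pt :=
    hPullback.ext ((ptdHomotopy_pt e u).trans rfl) (fun t => hLpt u t) w.map_pt
  -- The path along `u = 0` and then `τ = 1` is a reparametrization of the one along `u = 0`.
  have hE01 (c : C) (t : I) : hPushout.cyl (hPullback.fst k ι) (hPullback.snd k ι)
      (E (secondHalf t, c)) (firstHalf t) = hPushout.cyl _ _ (E (0, c)) (firstHalf t) := by
    rcases firstHalf_eq_one_or_secondHalf_eq_zero t with h | h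
    · rw [h, hPushout.cyl_one, hPushout.cyl_one]; rfl
    · rw [h]
  let M : PtdMap (hPushout v w) (hPushout (hPullback.fst k ι) (hPullback.snd k ι)) :=
    hPushout.desc ((hPushout.inl _ _).comp p) (hPushout.inr _ _)
      { toFun := fun x => hPushout.cyl _ _ (E (0, x.2)) (firstHalf x.1)
        continuous_toFun := hPushout.continuous_cyl
          (E.continuous.comp (continuous_const.prodMk continuous_snd))
          (continuous_firstHalf.comp continuous_fst)
        map_zero_left := fun c => by
          simp only [firstHalf_zero, hPushout.cyl_zero]
          exact congrArg (hPushout.inl _ _) (e.apply_zero c)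
        map_one_left := fun c => by
          simp only [firstHalf_one, hPushout.cyl_one]
          rfl
        prop' := fun t c hc => by
          have hc' : c = C.pt := hc
          subst hc'
          simp only [hEpt, ContinuousMap.coe_mk, hPushout.cyl_pt]
          exact ((congrArg (hPushout.inl _ _)
            ((congrArg p v.map_pt).trans p.map_pt)).trans (hPushout.inl _ _).map_pt).symm }
  refine PtdHomotopic.trans (q := M) ?_ ?_
  · refine hPushout.homotopic_of (fun _ a => hPushout.inl _ _ (p a))
      (fun s c t => hPushout.cyl _ _ (E (segment s t (secondHalf t), c))
        (segment s 0 (firstHalf t)))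
      (fun s b => hPushout.cyl _ _ (φ b) s)
      ((hPushout.inl _ _).toCont.continuous.comp (p.toCont.continuous.comp continuous_snd))
      (hPushout.continuous_cyl (E.continuous.comp ((continuous_segment continuous_fst
          (by fun_prop) (by fun_prop)).prodMk (by fun_prop)))
        (continuous_segment continuous_fst (by fun_prop) (by fun_prop)))
      (hPushout.continuous_cyl (φ.continuous.comp continuous_snd) continuous_fst)
      (fun s c => ?_) (fun s c => ?_)
      (fun s => (congrArg _ p.map_pt).trans (hPushout.inl _ _).map_pt)
      (fun s t => ?_) (fun a => rfl) (fun a => rfl)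
      (fun c t => ?_) (fun c t => ?_) (fun b => ?_) (fun b => ?_)
    · simp only [firstHalf_zero, secondHalf_zero, segment_self, hPushout.cyl_zero]
      exact congrArg (hPushout.inl _ _) (e.apply_zero c)
    · simp only [firstHalf_one, secondHalf_one, segment_self, segment_zero_one, hE1]
    · simp only [hEpt, hPushout.cyl_pt]
    · simp only [segment_zero, hPushout.cyl_zero]
      rfl
    · simp only [segment_one, hE01]
      rfl
    · simp only [hPushout.cyl_zero]
      rfl
    · simp only [hPushout.cyl_one]
      rfl
  · refine hPushout.homotopic_of (fun _ a => hPushout.inl _ _ (p a))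
      (fun s c t => hPushout.cyl _ _ (E (0, c)) (segment s (firstHalf t) t))
      (fun s b => hPushout.inr _ _ b)
      ((hPushout.inl _ _).toCont.continuous.comp (p.toCont.continuous.comp continuous_snd))
      (hPushout.continuous_cyl (E.continuous.comp (by fun_prop))
        (continuous_segment continuous_fst (by fun_prop) (by fun_prop)))
      ((hPushout.inr _ _).toCont.continuous.comp continuous_snd)
      (fun s c => ?_) (fun s c => ?_)
      (fun s => (congrArg _ p.map_pt).trans (hPushout.inl _ _).map_pt)
      (fun s t => ?_) (fun a => rfl) (fun a => rfl)
      (fun c t => ?_) (fun c t => ?_) (fun b => rfl) (fun b => rfl)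
    · simp only [firstHalf_zero, segment_self, hPushout.cyl_zero]
      exact congrArg (hPushout.inl _ _) (e.apply_zero c)
    · simp only [firstHalf_one, segment_self, hPushout.cyl_one]
      rfl
    · simp only [hEpt, hPushout.cyl_pt]
    · simp only [segment_zero]
      rfl
    · simp only [segment_one, hE0]
      rfl

end WhiskerLift

/-! ### The lifts of a relative suspension to the Ganea spaces -/

section GaneaLift

variable {A C X : PtdSpace.{u}} (ι : PtdMap A X)

theorem g_apply_α (n : ℕ) (a : A) : g ι n (α ι n a) = ι a :=
  congrArg (fun j : PtdMap A X => j a) (g_comp_α ι n)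

/-- The section `a ↦ (α_n a, const, a)` of `η_n : F_n → A`. -/
def diagonal (n : ℕ) : C(A, F ι n) :=
  hPullback.family (α ι n) (fun a _ => ι a) id (α ι n).toCont.continuous
    (ι.toCont.continuous.comp continuous_fst) continuous_id (fun a => (g_apply_α ι n a).symm)
    (fun _ => rfl)

theorem diagonal_pt (n : ℕ) : diagonal ι n A.pt = (F ι n).pt :=
  hPullback.ext (α ι n).map_pt (fun _ => ι.map_pt) rfl

variable {ι} {v w : PtdMap C A} (H : PtdHomotopy (ι.comp v) (ι.comp w))

/-- The lift to `G_{n+1}` of the whisker map `(ι, ι) : hPushout v w → X` formed with `H`. -/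
def ganeaLift (n : ℕ) : PtdMap (hPushout v w) (G ι (n + 1)) :=
  whiskerLift (k := g ι n) (α ι n) (ContinuousMap.HomotopyRel.cast H
    (congrArg (fun j : PtdMap A X => (j.comp v).toCont) (g_comp_α ι n).symm) rfl)

/-- The two lifts to `G_{n+2}` are homotopic: the homotopy is the canonical one
`γ_n ∘ α_n ≃ α_{n+1}` on both copies of `A`. -/
theorem γ_comp_ganeaLift (n : ℕ) :
    PtdHomotopic ((γ ι (n + 1)).comp (ganeaLift H n)) (ganeaLift H (n + 1)) := by
  have hpt (t : I) : H (t, C.pt) = X.pt := ptdHomotopy_pt H t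
  refine PtdHomotopic.trans (q := whiskerLift (k := g ι (n + 1)) ((γ ι n).comp (α ι n))
    (ContinuousMap.HomotopyRel.cast H
      (congrArg (fun j : PtdMap A X => (j.comp v).toCont) (g_comp_α ι n).symm) rfl)) ?_ ?_
  · refine inl_comp_desc_homotopic (k := g ι (n + 1)) (ι := ι) (fun u t c => H (max u t, c))
      (fun _ b => ι b) (H.continuous.comp (by fun_prop))
      (ι.toCont.continuous.comp continuous_fst)
      (fun u c => ?_) (fun u c => ?_) (fun t c => ?_) (fun t c => ?_)
      (fun b => (g_apply_α ι (n + 1) b).symm) (fun b => rfl) (fun u t => hpt _)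
    · rw [max_eq_left (show (0 : I) ≤ u from unitInterval.nonneg')]; rfl
    · rw [max_eq_right (show u ≤ 1 from unitInterval.le_one')]; exact H.apply_one c
    · rw [max_eq_right (show (0 : I) ≤ t from unitInterval.nonneg')]; rfl
    · rw [max_eq_left (show t ≤ 1 from unitInterval.le_one')]; exact H.apply_one c
  · refine whiskerLift_homotopic (k := g ι (n + 1)) (ι := ι)
      (fun s a => hPushout.cyl (β ι n) (η ι n) (diagonal ι n a) s) (fun _ t c => H (t, c))
      (hPushout.continuous_cyl ((diagonal ι n).continuous.comp continuous_snd) continuous_fst)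
      (H.continuous.comp (by fun_prop))
      (fun a => hPushout.cyl_zero _) (fun a => hPushout.cyl_one _)
      (fun s => ?_) (fun s c => H.apply_zero c) (fun s c => H.apply_one c)
      (fun t c => rfl) (fun t c => rfl) (fun s t => hpt t)
    rw [diagonal_pt]; exact hPushout.cyl_pt s

theorem γIter_succ (k n : ℕ) (h : k ≤ n) :
    γIter ι k (n + 1) (Nat.le_succ_of_le h) = (γ ι n).comp (γIter ι k n h) :=
  Nat.leRec_succ _ _ h

theorem γIter_self (k : ℕ) : γIter ι k k le_rfl = PtdMap.id _ := Nat.leRec_self _ _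

/-- The maps `γ` carry the lift to `G_1` to the lift to `G_{n+1}`, up to homotopy. -/
theorem γIter_comp_ganeaLift (n : ℕ) :
    PtdHomotopic ((γIter ι 1 (n + 1) (Nat.le_add_left 1 n)).comp (ganeaLift H 0))
      (ganeaLift H n) := by
  induction n with
  | zero => rw [γIter_self]; exact PtdHomotopic.refl _
  | succ n ih =>
    rw [γIter_succ 1 (n + 1) (Nat.le_add_left 1 n)]
    exact (ih.postcomp (γ ι (n + 1))).trans (γ_comp_ganeaLift H n)

theorem ganeaLift_zero : ganeaLift (hPullback.homotopy ι ι) 0 = PtdMap.id (G ι 1) :=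
  PtdMap.ext_apply (hPushout.ind (fun _ => rfl) (fun _ _ => rfl) fun _ => rfl)

/-- Applied to the homotopy pushout `G_1` itself, `ganeaLift` gives the maps `γ_{1,n+1}`. -/
theorem γIter_homotopic_ganeaLift (n : ℕ) :
    PtdHomotopic (γIter ι 1 (n + 1) (Nat.le_add_left 1 n))
      (ganeaLift (hPullback.homotopy ι ι) n) := by
  have h := γIter_comp_ganeaLift (hPullback.homotopy ι ι) n
  rw [ganeaLift_zero] at h
  exact h

end GaneaLift

section Hopf

variable {W A S X : PtdSpace.{u}} (D : RelSuspension W A S) (f : PtdMap S X)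

namespace RelSuspension

theorem desc_comp_comparisonInv :
    PtdHomotopic ((hPushout.desc D.θ D.θ D.H).comp D.comparisonInv) (PtdMap.id S) :=
  (Classical.choose_spec D.isPushout).1

theorem comparisonInv_comp_desc :
    PtdHomotopic (D.comparisonInv.comp (hPushout.desc D.θ D.θ D.H)) (PtdMap.id _) :=
  (Classical.choose_spec D.isPushout).2

end RelSuspension

theorem omegaSucc_comp_θ (n : ℕ) :
    PtdHomotopic ((omegaSucc D f n).comp D.θ) (α (iotaX D f) (n + 1)) :=
  (D.comparisonInv_comp_desc.precomp (hPushout.inr D.β D.η)).postcomp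
    (ganeaLift (ι := iotaX D f) (postcompHomotopy f D.H) n)

theorem g_comp_omegaSucc (n : ℕ) :
    PtdHomotopic ((g (iotaX D f) (n + 1)).comp (omegaSucc D f n)) f := by
  have h : (g (iotaX D f) (n + 1)).comp
      (ganeaLift (ι := iotaX D f) (postcompHomotopy f D.H) n) =
      f.comp (hPushout.desc D.θ D.θ D.H) :=
    PtdMap.ext_apply (hPushout.ind (g_apply_α _ n) (fun _ _ => rfl) fun _ => rfl)
  have h' := D.desc_comp_comparisonInv.postcomp f
  have e : (g (iotaX D f) (n + 1)).comp (omegaSucc D f n) =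
      f.comp ((hPushout.desc D.θ D.θ D.H).comp D.comparisonInv) :=
    congrArg (fun q : PtdMap _ _ => q.comp D.comparisonInv) h
  rw [e]
  exact h'

theorem γIter_comp_omegaSucc (n : ℕ) :
    PtdHomotopic ((γIter (iotaX D f) 1 (n + 1) (Nat.le_add_left 1 n)).comp (omegaSucc D f 0))
      (omegaSucc D f n) :=
  (γIter_comp_ganeaLift (ι := iotaX D f) (postcompHomotopy f D.H) n).precomp D.comparisonInv

end Hopf

/-! ### The effect of a map on the Ganea construction -/

section Functoriality

variable {A B X : PtdSpace.{u}}

/-- If `j = f ∘ θ`, then `θ` induces maps `G_n(j) → G_n(f)` over `X`. -/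
theorem exists_ganea_map (f : PtdMap B X) (θ : PtdMap A B) (n : ℕ) :
    ∃ φ : PtdMap (G (f.comp θ) n) (G f n), (g f n).comp φ = g (f.comp θ) n := by
  induction n with
  | zero => exact ⟨θ, rfl⟩
  | succ n ih =>
    obtain ⟨φ, hφ⟩ := ih
    let ι := f.comp θ
    let c : PtdMap (G ι (n + 1)) (hPushout (β ι n) (θ.comp (η ι n))) :=
      hPushout.desc (hPushout.inl _ _) ((hPushout.inr _ _).comp θ)
        (hPushout.homotopy (β ι n) (θ.comp (η ι n)))
    let ψ : PtdMap (hPushout (β ι n) (θ.comp (η ι n))) (G f (n + 1)) :=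
      whiskerLift (k := g f n) (ι := f) φ ((hPullback.homotopy (g ι n) ι).cast
        (congrArg (fun q : PtdMap _ _ => (q.comp (β ι n)).toCont) hφ.symm) rfl)
    exact ⟨ψ.comp c, PtdMap.ext_apply (hPushout.ind
      (fun a => congrArg (fun q : PtdMap _ _ => q a) hφ) (fun _ _ => rfl) fun _ => rfl)⟩

end Functoriality

/-! ### Comparing a homotopy section with the canonical lift -/

section Section

variable {A C G X : PtdSpace.{u}} {k : PtdMap G X} {ι : PtdMap A X} {a : PtdMap A G}
  {r : PtdMap X G} {v w : PtdMap C A}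

/-- Let `r` be a homotopy section of `k`, by `R : k ∘ r ≃ id`, and let `T : r ∘ ι ≃ a` where
`k ∘ a = ι`. In the pushout of `G ← hPullback k ι → A`, the composite of `r` with the whisker map
`(ι, ι)` formed with `H` becomes homotopic to the canonical lift of that whisker map.

The homotopies `R ∘ ι` and `k ∘ T` from `k ∘ r ∘ ι` to `ι` need not agree. The discrepancy is the
loop at `ι x` that runs back along `k ∘ T` and then along `R ∘ ι`; moving the starting point of
the lift along its image under `r` removes it. The paths that accompany the moving point are `R`
applied on the diagonal: a path `l` in `X` gives the path `t ↦ R (t, l t)` from `k (r (l 0))` to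
`l 1`. -/
theorem inl_comp_section_comp_desc_homotopic (ha : k.comp a = ι)
    (R : PtdHomotopy (k.comp r) (PtdMap.id X))
    (T : PtdHomotopy (r.comp ι) a) (H : PtdHomotopy (ι.comp v) (ι.comp w)) :
    PtdHomotopic
      ((hPushout.inl (hPullback.fst k ι) (hPullback.snd k ι)).comp
        (r.comp (hPushout.desc ι ι H)))
      (whiskerLift a
        (H.cast (congrArg (fun j : PtdMap A X => (j.comp v).toCont) ha.symm) rfl)) := by
  have hka (x : A) : k (a x) = ι x := congrArg (fun j : PtdMap A X => j x) ha
  have hR0 (x : X) : R (0, x) = k (r x) := R.apply_zero x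
  have hR1 (x : X) : R (1, x) = x := R.apply_one x
  have hRpt (t : I) : R (t, X.pt) = X.pt := ptdHomotopy_pt R t
  have hT0 (x : A) : T (0, x) = r (ι x) := T.apply_zero x
  have hT1 (x : A) : T (1, x) = a x := T.apply_one x
  have hTpt (t : I) : T (t, A.pt) = G.pt := ptdHomotopy_pt T t
  have hH0 (c : C) : H (0, c) = ι (v c) := H.apply_zero c
  have hH1 (c : C) : H (1, c) = ι (w c) := H.apply_one c
  have hHpt (t : I) : H (t, C.pt) = X.pt := ptdHomotopy_pt H t
  have hv := v.map_pt
  have hι := ι.map_pt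
  have hk := k.map_pt
  have hr := r.map_pt
  have cR := R.continuous
  have cT := T.continuous
  have cH := H.continuous
  have cv := v.toCont.continuous
  have cι := ι.toCont.continuous
  have ck := k.toCont.continuous
  have cr := r.toCont.continuous
  -- `q 1` is the concatenation of `k ∘ T` with `H`.
  let q (s t : I) (c : C) : X := prepend (fun t => k (T (t, v c))) (fun t => H (t, c)) s t
  have hq (c : C) : k (T (1, v c)) = H (0, c) := by rw [hT1, hka, hH0]
  have cq : Continuous fun x : I × I × C => q x.1 x.2.1 x.2.2 :=
    continuous_prepend (τ := fun (x : I × I × C) t => k (T (t, v x.2.2)))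
      (p := fun x t => H (t, x.2.2)) (by fun_prop) (by fun_prop) (fun x => hq _)
      (by fun_prop) (by fun_prop)
  have q_zero (t : I) (c : C) : q 0 t c = H (t, c) := prepend_zero (hq c) t
  have q_left (s : I) (c : C) : q s 0 c = k (T (σ s, v c)) := prepend_left s
  have q_right (s : I) (c : C) : q s 1 c = ι (w c) := (prepend_right s).trans (hH1 c)
  have q_pt (s t : I) : q s t C.pt = X.pt :=
    prepend_of_forall_eq (fun t => by rw [hv, hTpt, hk]) hHpt s t
  -- `q' 1` is the concatenation of the inverse of `R ∘ ι` with `q 1`.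
  let q' (s t : I) (c : C) : X := prepend (fun t => R (σ t, ι (v c))) (fun t => q 1 t c) s t
  have hq' (c : C) : R (σ 1, ι (v c)) = q 1 0 c := by
    rw [q_left, unitInterval.symm_one, hR0, hT0]
  have cq' : Continuous fun x : I × I × C => q' x.1 x.2.1 x.2.2 :=
    continuous_prepend (τ := fun (x : I × I × C) t => R (σ t, ι (v x.2.2)))
      (p := fun x t => q 1 t x.2.2) (by fun_prop) (by fun_prop) (fun x => hq' _)
      (by fun_prop) (by fun_prop)
  have q'_zero (t : I) (c : C) : q' 0 t c = q 1 t c := prepend_zero (hq' c) t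
  have q'_left (s : I) (c : C) : q' s 0 c = R (s, ι (v c)) :=
    (prepend_left s).trans (by rw [unitInterval.symm_symm])
  have q'_right (s : I) (c : C) : q' s 1 c = ι (w c) := (prepend_right s).trans (q_right 1 c)
  have q'_pt (s t : I) : q' s t C.pt = X.pt :=
    prepend_of_forall_eq (fun t => by rw [hv, hι, hRpt]) (q_pt 1) s t
  -- `m` contracts the concatenation of `R ∘ ι`, its inverse and `q 1` to `q 1`.
  let m (s t : I) (c : C) : X :=
    prepend (fun t => R (truncSum s t, ι (v c))) (fun t => q' s t c) s t
  have hm (s : I) (c : C) : R (truncSum s 1, ι (v c)) = q' s 0 c := by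
    rw [truncSum_one_right, q'_left]
  have cm : Continuous fun x : I × I × C => m x.1 x.2.1 x.2.2 :=
    continuous_prepend (τ := fun (x : I × I × C) t => R (truncSum x.1 t, ι (v x.2.2)))
      (p := fun x t => q' x.1 t x.2.2)
      (cR.comp ((continuous_truncSum (by fun_prop) (by fun_prop)).prodMk (by fun_prop)))
      (by fun_prop) (fun x => hm _ _) (by fun_prop) (by fun_prop)
  have m_zero (t : I) (c : C) : m 0 t c = q 1 t c := (prepend_zero (hm 0 c) t).trans (q'_zero t c)
  have m_one (t : I) (c : C) : m 1 t c = R (firstHalf t, q' 1 (secondHalf t) c) := by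
    rw [← prepend_one (fun x y => R (x, q' 1 y c))]
    simp only [m, truncSum_one_left, q'_left, hR1]
  have m_left (s : I) (c : C) : m s 0 c = k (r (ι (v c))) := by
    refine (prepend_left s).trans ?_
    rw [truncSum_symm, hR0]
  have m_right (s : I) (c : C) : m s 1 c = ι (w c) := (prepend_right s).trans (q'_right s c)
  have m_pt (s t : I) : m s t C.pt = X.pt :=
    prepend_of_forall_eq (fun t => by rw [hv, hι, hRpt]) (q'_pt s) s t
  let H₁ : PtdHomotopy (k.comp ((r.comp ι).comp v)) (ι.comp w) :=
    PtdHomotopy.mk (fun t c => R (t, H (t, c))) (by fun_prop)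
      (fun c => by rw [hR0, hH0]; rfl) (fun c => by rw [hR1, hH1]; rfl)
      (fun t => by rw [hHpt, hRpt])
  let H₂ : PtdHomotopy (k.comp ((r.comp (k.comp (r.comp ι))).comp v)) (ι.comp w) :=
    PtdHomotopy.mk (fun t c => R (t, q 1 t c)) (by fun_prop)
      (fun c => by rw [hR0, q_left, unitInterval.symm_one, hT0]; rfl)
      (fun c => by rw [hR1, q_right]; rfl) (fun t => by rw [q_pt, hRpt])
  let H₃ : PtdHomotopy (k.comp ((r.comp ι).comp v)) (ι.comp w) :=
    PtdHomotopy.mk (fun t c => R (t, q' 1 t c)) (by fun_prop)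
      (fun c => by rw [hR0, q'_left, hR1]; rfl)
      (fun c => by rw [hR1, q'_right]; rfl) (fun t => by rw [q'_pt, hRpt])
  let H₄ : PtdHomotopy (k.comp ((r.comp ι).comp v)) (ι.comp w) :=
    PtdHomotopy.mk (m 1) (by fun_prop) (m_left 1) (m_right 1) (m_pt 1)
  let H₅ : PtdHomotopy (k.comp ((r.comp ι).comp v)) (ι.comp w) :=
    PtdHomotopy.mk (q 1) (by fun_prop)
      (fun c => by rw [q_left, unitInterval.symm_one, hT0]; rfl) (q_right 1) (q_pt 1)
  -- Trade the homotopy `r ∘ H` for the cylinder coordinate.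
  have s₀ : PtdHomotopic ((hPushout.inl (hPullback.fst k ι) (hPullback.snd k ι)).comp
      (hPushout.desc (r.comp ι) (r.comp ι) (postcompHomotopy r H)))
      (whiskerLift (r.comp ι) H₁) :=
    inl_comp_desc_homotopic (fun u t c => R (t, H (max u t, c))) (fun t x => R (t, ι x))
      (by fun_prop) (by fun_prop)
      (fun u c => by rw [max_eq_left (show (0 : I) ≤ u from unitInterval.nonneg'), hR0]; rfl)
      (fun u c => by
        rw [max_eq_right (show u ≤ 1 from unitInterval.le_one'), hR1, hH1])
      (fun t c => by rw [max_eq_right (show (0 : I) ≤ t from unitInterval.nonneg')]; rfl)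
      (fun t c => by rw [max_eq_left (show t ≤ 1 from unitInterval.le_one'), hH1])
      (fun x => hR0 _) (fun x => hR1 _) (fun u t => by rw [hHpt, hRpt])
  -- Move the starting point along the discrepancy loop: back along `k ∘ T`, then along `R ∘ ι`.
  have s₁ : PtdHomotopic (whiskerLift (r.comp ι) H₁)
      (whiskerLift (r.comp (k.comp (r.comp ι))) H₂) :=
    whiskerLift_homotopic (fun s x => r (k (T (σ s, x)))) (fun s t c => R (t, q s t c))
      (by fun_prop) (by fun_prop)
      (fun x => by rw [unitInterval.symm_zero, hT1, hka]; rfl)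
      (fun x => by rw [unitInterval.symm_one, hT0]; rfl)
      (fun s => by rw [hTpt, hk, hr])
      (fun s c => by rw [q_left, hR0]) (fun s c => by rw [q_right, hR1])
      (fun t c => by rw [q_zero]; rfl) (fun t c => rfl) (fun s t => by rw [q_pt, hRpt])
  have s₂ : PtdHomotopic (whiskerLift (r.comp (k.comp (r.comp ι))) H₂)
      (whiskerLift (r.comp ι) H₃) :=
    whiskerLift_homotopic (fun s x => r (R (s, ι x))) (fun s t c => R (t, q' s t c))
      (by fun_prop) (by fun_prop)
      (fun x => by rw [hR0]; rfl) (fun x => by rw [hR1]; rfl)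
      (fun s => by rw [hι, hRpt, hr])
      (fun s c => by rw [q'_left, hR0]) (fun s c => by rw [q'_right, hR1])
      (fun t c => by rw [q'_zero]; rfl) (fun t c => rfl) (fun s t => by rw [q'_pt, hRpt])
  -- Straighten the diagonal of `(x, y) ↦ R (x, q' 1 y)` to two sides of the square. The side
  -- `x = 1` is `q' 1`, which cancels the side `y = 0`, that is `R ∘ ι`, and leaves `q 1`.
  have s₃ : PtdHomotopic (whiskerLift (r.comp ι) H₃) (whiskerLift (r.comp ι) H₄) :=
    whiskerLift_homotopic (fun _ x => r (ι x))
      (fun s t c => R (segment s t (firstHalf t), q' 1 (segment s t (secondHalf t)) c))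
      (by fun_prop)
      (cR.comp ((continuous_segment (by fun_prop) (by fun_prop) (by fun_prop)).prodMk
        (cq'.comp (continuous_const.prodMk ((continuous_segment (by fun_prop) (by fun_prop)
          (by fun_prop)).prodMk (by fun_prop))))))
      (fun x => rfl) (fun x => rfl) (fun s => by rw [hι, hr])
      (fun s c => by rw [firstHalf_zero, secondHalf_zero, segment_self, hR0, q'_left, hR1])
      (fun s c => by rw [firstHalf_one, secondHalf_one, segment_self, hR1, q'_right])
      (fun t c => by rw [segment_zero, segment_zero]; rfl)
      (fun t c => by rw [segment_one, segment_one, ← m_one]; rfl)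
      (fun s t => by rw [q'_pt, hRpt])
  have s₄ : PtdHomotopic (whiskerLift (r.comp ι) H₄) (whiskerLift (r.comp ι) H₅) :=
    whiskerLift_homotopic (fun _ x => r (ι x)) (fun s t c => m (σ s) t c)
      (by fun_prop) (by fun_prop) (fun x => rfl) (fun x => rfl) (fun s => by rw [hι, hr])
      (fun s c => m_left _ c) (fun s c => m_right _ c)
      (fun t c => by rw [unitInterval.symm_zero]; rfl)
      (fun t c => by rw [unitInterval.symm_one, m_zero]; rfl) (fun s t => m_pt _ t)
  -- Move the starting point along `T`, which uses up the initial part `k ∘ T` of `q 1`.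
  have s₅ : PtdHomotopic (whiskerLift (r.comp ι) H₅) (whiskerLift a
      (H.cast (congrArg (fun j : PtdMap A X => (j.comp v).toCont) ha.symm) rfl)) :=
    whiskerLift_homotopic (fun s x => T (s, x)) (fun s t c => q (σ s) t c)
      (by fun_prop) (by fun_prop) hT0 hT1 hTpt
      (fun s c => by rw [q_left, unitInterval.symm_symm]) (fun s c => q_right _ c)
      (fun t c => by rw [unitInterval.symm_zero]; rfl)
      (fun t c => by rw [unitInterval.symm_one, q_zero]; rfl) (fun s t => q_pt _ t)
  have e : r.comp (hPushout.desc ι ι H) =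
      hPushout.desc (r.comp ι) (r.comp ι) (postcompHomotopy r H) :=
    PtdMap.ext_apply (hPushout.ind (fun _ => rfl) (fun _ _ => rfl) fun _ => rfl)
  rw [e]
  exact ((((s₀.trans s₁).trans s₂).trans s₃).trans s₄).trans s₅

end Section

/-! ### The inequalities -/

section Inequalities

variable {W A S X : PtdSpace.{u}}

theorem secat_le_relcat_comp (f : PtdMap S X) (θ : PtdMap A S) :
    secat f ≤ relcat (f.comp θ) := by
  refine le_iInf₂ fun n ⟨r, hr, _⟩ => ?_
  obtain ⟨φ, hφ⟩ := exists_ganea_map f θ n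
  refine iInf₂_le n ⟨φ.comp r, ?_⟩
  have e : (g f n).comp (φ.comp r) = (g (f.comp θ) n).comp r :=
    congrArg (fun j : PtdMap _ _ => j.comp r) hφ
  rw [IsGaneaSection, e]
  exact hr

theorem relcat_le_hcat (D : RelSuspension W A S) (f : PtdMap S X) :
    relcat (iotaX D f) ≤ hcat D f :=
  le_iInf₂ fun m ⟨r, hr, h⟩ => iInf₂_le (m + 1)
    ⟨r, hr, (h.precomp D.θ).trans (omegaSucc_comp_θ D f m)⟩

theorem hcat_le_relcatOrder_one (D : RelSuspension W A S) (f : PtdMap S X) :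
    hcat D f ≤ relcatOrder (iotaX D f) 1 := by
  refine le_iInf₂ fun n ⟨hn, r, hr, h⟩ => ?_
  obtain ⟨m, rfl⟩ := Nat.exists_eq_add_of_le' hn
  exact iInf₂_le m ⟨r, hr, (((g_comp_omegaSucc D f 0).symm.postcomp r).trans
    (h.precomp (omegaSucc D f 0))).trans (γIter_comp_omegaSucc D f m)⟩

/-- A homotopy section `r` of `g_n` with `r ∘ ι ≃ α_n` gives the homotopy section `γ_n ∘ r` of
`g_{n+1}`, which satisfies `γ_n ∘ r ∘ g_1 ≃ γ_{1,n+1}`. -/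
theorem relcatOrder_one_le_relcat_add_one (ι : PtdMap A X) :
    relcatOrder ι 1 ≤ relcat ι + 1 := by
  rw [relcat, ENat.iInf_add]
  refine le_iInf fun n => ?_
  rw [ENat.iInf_add]
  refine le_iInf fun ⟨r, ⟨R⟩, ⟨T⟩⟩ => iInf₂_le (n + 1)
    ⟨Nat.le_add_left 1 n, (γ ι n).comp r, ⟨R⟩, ?_⟩
  exact (inl_comp_section_comp_desc_homotopic (g_comp_α ι n) R T (hPullback.homotopy ι ι)).trans
    (γIter_homotopic_ganeaLift n).symm

end Inequalities

end HopfCat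

theorem proposition1 {W A S X : HopfCat.PtdSpace.{u}} (D : HopfCat.RelSuspension W A S)
    (f : HopfCat.PtdMap S X) :
    HopfCat.secat f ≤ HopfCat.relcat (HopfCat.iotaX D f) ∧
    HopfCat.relcat (HopfCat.iotaX D f) ≤ HopfCat.hcat D f ∧
    HopfCat.hcat D f ≤ HopfCat.relcatOrder (HopfCat.iotaX D f) 1 ∧
    HopfCat.relcatOrder (HopfCat.iotaX D f) 1 ≤ HopfCat.relcat (HopfCat.iotaX D f) + 1 ∧
    (HopfCat.hcat D f = HopfCat.relcat (HopfCat.iotaX D f) ∨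
      HopfCat.hcat D f = HopfCat.relcat (HopfCat.iotaX D f) + 1) := by
  have h₁ := HopfCat.relcat_le_hcat D f
  have h₂ := HopfCat.hcat_le_relcatOrder_one D f
  have h₃ := HopfCat.relcatOrder_one_le_relcat_add_one (HopfCat.iotaX D f)
  refine ⟨HopfCat.secat_le_relcat_comp f D.θ, h₁, h₂, h₃, ?_⟩
  rcases h₁.eq_or_lt with h | h
  · exact Or.inl h.symm
  · exact Or.inr ((h₂.trans h₃).antisymm (Order.add_one_le_of_lt h))
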